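/- Let $\mathsf d\ge 1$ and let $\Gamma_0=\{\eta\subset\mathbb R^{\mathsf d}: |\eta|<\infty\}$ be the space of finite configurations. For $|\eta|=|\zeta|$ let $\rho(\eta,\zeta)=\min_{\varsigma}\max_{x\in\eta}|\varsigma(x)-x|$, the minimum being over all bijections $\varsigma:\eta\to\zeta$ (and $\rho(\varnothing,\varnothing)=0$). Give each $\Gamma_0^{(n)}=\{\eta:|\eta|=n\}$ the topology of the metric $\rho$ and $\Gamma_0=\bigsqcup_n\Gamma_0^{(n)}$ the disjoint union topology, and let $\mathscr B(\Gamma_0)$ be the $\sigma$-algebra generated by $\{\varnothing\}$ and the balls $\{\zeta:|\zeta|=|\eta|,\ \rho(\eta,\zeta)\le a\}$, $\eta\in\Gamma_0$, $a>0$. The Lebesgue–Poisson measure is $\lambda=\sum_{n\ge0}\frac1{n!}\lambda^{(n)}$, where $\lambda^{(0)}=\delta_{\varnothing}$ and, for $n\ge1$, $\lambda^{(n)}$ is the image of Lebesgue measure on the $n$-tuples of pairwise distinct points of $\mathbb R^{\mathsf d}$ under $(x_1,\dots,x_n)\mapsto\{x_1,\dots,x_n\}$. Let $b,d:\mathbb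 R^{\mathsf d}\times\Gamma_0\to[0,\infty)$ be (jointly) continuous functions such that 1. there are $c_1,c_2>0$ with $\int_{\mathbb R^{\mathsf d}}b(x,\eta)\,dx\le c_1|\eta|+c_2$ for all $\eta\in\Gamma_0$; 2. $\sup_{x\in\mathbb R^{\mathsf d},\,|\eta|\le m}d(x,\eta)<\infty$ for every $m\in\mathbb N$; 3. $\inf_{\eta\in\Gamma_0,\,x\in\eta}d(x,\eta)>0$; 4. there are $r>0$, $c_3>0$ and an open ball $B_\varnothing\subset\mathbb R^{\mathsf d}$ such that $b(x,\eta)>c_3$ whenever $|x-y|\le r$ for some $y\in\eta$, and $b(x,\varnothing)>c_3$ for all $x\in B_\varnothing$. Put $(B+D)(\eta)=\int_{\mathbb R^{\mathsf d}}b(x,\eta)\,dx+\sum_{x\in\eta}d(x,\eta)$, and let $(\xi_n)_{n\ge0}$ be the Markov chain on $\Gamma_0$ with transition probabilities $$Q(\eta,A)=\frac{1}{(B+D)(\eta)}\Big(\int_{\mathbb R^{\mathsf d}}\mathbf 1_A(\eta\cup\{x\})\,b(x,\eta)\,dx+\sum_{x\in\eta}\mathbf 1_A(\eta\setminus\{x\})\,d(x,\eta)\Big),$$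 and let $Q_\alpha$ be its law on $\Gamma_0^{\{0,1,2,\dots\}}$ when $\xi_0=\alpha$. Then $\lambda$ is a maximal irreducibility measure for $(\xi_n)$; that is, $\lambda$ is a non-trivial $\sigma$-finite measure and for every $A\in\mathscr B(\Gamma_0)$ $$\big(Q_\alpha\{\xi_n\in A\text{ for some }n\ge1\}>0\ \text{ for every }\alpha\in\Gamma_0\big)\iff\lambda(A)>0 .$$ -/

import Mathlib

open MeasureTheory ProbabilityTheory
open scoped ENNReal NNReal Nat

noncomputable section

/-! ## Markov chains and maximal irreducibility measures -/

/-- The law `P_μ` on the canonical space `X^ℕ` of the time-homogeneous Markov chain with transition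
kernel `P` and initial distribution `μ`. -/
def chainLaw {X : Type*} [MeasurableSpace X] (P : Kernel X X) [IsMarkovKernel P] (μ : Measure X) :
    Measure (ℕ → X) :=
  Kernel.trajMeasure (X := fun _ => X) μ fun n =>
    P.comap (fun h : (i : Finset.Iic n) → X => h ⟨n, Finset.mem_Iic.2 le_rfl⟩)
      (measurable_pi_apply _)

/-- The return probability `L(x, A) = P_x {Φ_n ∈ A for some n ≥ 1}`. -/
def returnProb {X : Type*} [MeasurableSpace X] (P : Kernel X X) [IsMarkovKernel P] (x : X)
    (A : Set X) : ℝ≥0∞ :=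
  chainLaw P (Measure.dirac x) {Φ | ∃ n, 1 ≤ n ∧ Φ n ∈ A}

/-- `ψ` is a maximal irreducibility measure for the chain with transition kernel `P`: it is a
non-trivial σ-finite measure whose sets of positive measure are exactly the measurable sets that
the chain enters with positive probability from every starting point. -/
structure IsMaximalIrreducibilityMeasure {X : Type*} [MeasurableSpace X] (P : Kernel X X)
    [IsMarkovKernel P] (ψ : Measure X) : Prop where
  sigmaFinite : SigmaFinite ψ
  nontrivial : ψ ≠ 0
  pos_iff : ∀ A : Set X, MeasurableSet A → ((∀ x, 0 < returnProb P x A) ↔ 0 < ψ A)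

/-! ## Finite configurations -/

/-- The Euclidean space `ℝ^dim`. -/
abbrev Space (dim : ℕ) : Type := EuclideanSpace ℝ (Fin dim)

/-- The space `Γ₀(ℝ^dim)` of finite subsets of `ℝ^dim`. (A structure, so as not to inherit the
measurable structure that Mathlib puts on `Finset`.) -/
@[ext]
structure FinConf (dim : ℕ) : Type where
  pts : Finset (Space dim)

namespace FinConf

variable {dim : ℕ}

/-- The number of points `|η|`. -/
def card (η : FinConf dim) : ℕ := η.pts.card

/-- The empty configuration. -/
def empty : FinConf dim := ⟨∅⟩

open Classical in
/-- `η ∪ {x}`. -/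
def insert (x : Space dim) (η : FinConf dim) : FinConf dim := ⟨Insert.insert x η.pts⟩

open Classical in
/-- `η \ {x}`. -/
def erase (η : FinConf dim) (x : Space dim) : FinConf dim := ⟨η.pts.erase x⟩

/-- `ρ(η, ζ)`, the minimum over all bijections `σ : η → ζ` of `max_{x ∈ η} |σ x - x|`.
Used only for configurations with the same number of points (it is `0` for `η = ζ = ∅`). -/
def rho (η ζ : FinConf dim) : ℝ :=
  ⨅ σ : η.pts ≃ ζ.pts, ⨆ x : η.pts, dist (σ x : Space dim) (x : Space dim)

/-- The closed ball of radius `a` around `η` inside the configurations with `|η|` points. -/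
def cball (η : FinConf dim) (a : ℝ) : Set (FinConf dim) :=
  {ζ | ζ.card = η.card ∧ rho η ζ ≤ a}

/-- The topology of `Γ₀`: the disjoint union over `n` of the spaces of `n`-point configurations,
each with the topology of the metric `ρ`. -/
instance : TopologicalSpace (FinConf dim) where
  IsOpen U := ∀ η ∈ U, ∃ a : ℝ, 0 < a ∧ cball η a ⊆ U
  isOpen_univ := fun _ _ => ⟨1, one_pos, Set.subset_univ _⟩
  isOpen_inter := by
    rintro U V hU hV η ⟨h1, h2⟩
    obtain ⟨a, ha, hsa⟩ := hU η h1
    obtain ⟨b, hb, hsb⟩ := hV η h2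
    exact ⟨min a b, lt_min ha hb, fun ζ hζ =>
      ⟨hsa ⟨hζ.1, hζ.2.trans (min_le_left _ _)⟩, hsb ⟨hζ.1, hζ.2.trans (min_le_right _ _)⟩⟩⟩
  isOpen_sUnion := by
    rintro S hS η ⟨U, hU, hη⟩
    obtain ⟨a, ha, hsa⟩ := hS U hU η hη
    exact ⟨a, ha, hsa.trans (Set.subset_sUnion_of_mem hU)⟩

/-- The σ-algebra of `Γ₀`, generated by `{∅}` and the balls of `ρ`. -/
instance : MeasurableSpace (FinConf dim) :=
  MeasurableSpace.generateFrom
    (Insert.insert {empty} {B | ∃ (η : FinConf dim) (a : ℝ), 0 < a ∧ B = cball η a})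

/-- The `n`-tuples of pairwise distinct points of `ℝ^dim`. -/
abbrev Tuple (dim n : ℕ) : Type := {t : Fin n → Space dim // Function.Injective t}

open Classical in
/-- The map `(x₁, …, x_n) ↦ {x₁, …, x_n}`, on arbitrary tuples. -/
def ofTuple {n : ℕ} (t : Fin n → Space dim) : FinConf dim := ⟨Finset.univ.image t⟩

/-- The map `sym`, that is `(x₁, …, x_n) ↦ {x₁, …, x_n}` on tuples of distinct points. -/
def sym {n : ℕ} (t : Tuple dim n) : FinConf dim := ofTuple t.1

/-- The Lebesgue–Poisson measure `λ = ∑ₙ (1/n!) λ⁽ⁿ⁾`, where `λ⁽ⁿ⁾` is the image under `sym` of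
the Lebesgue measure of `(ℝ^dim)^n` restricted to the tuples of distinct points. -/
def lebesguePoisson (dim : ℕ) : Measure (FinConf dim) :=
  Measure.sum fun n : ℕ =>
    ((n ! : ℕ) : ℝ≥0∞)⁻¹ • Measure.map ofTuple
      ((volume : Measure (Fin n → Space dim)).restrict {t | Function.Injective t})

/-! ### Measurability facts that the transition kernel needs -/

lemma mem_cball_iff {η ζ : FinConf dim} {a : ℝ} (ha : 0 ≤ a) :
    ζ ∈ cball η a ↔ ∃ σ : η.pts ≃ ζ.pts, ∀ x, dist (σ x : Space dim) (x : Space dim) ≤ a := by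
  constructor
  · rintro ⟨h1, h2⟩
    have : Nonempty (η.pts ≃ ζ.pts) := ⟨Finset.equivOfCardEq h1.symm⟩
    obtain ⟨σ, hσ⟩ := exists_eq_ciInf_of_finite
      (f := fun σ : η.pts ≃ ζ.pts => ⨆ x : η.pts, dist (σ x : Space dim) (x : Space dim))
    refine ⟨σ, fun x => ?_⟩
    have h3 : ⨆ x : η.pts, dist (σ x : Space dim) (x : Space dim) ≤ a := by
      rw [hσ]; exact h2
    exact (le_ciSup (Set.finite_range _).bddAbove x).trans h3
  · rintro ⟨σ, hσ⟩
    refine ⟨(Finset.card_eq_of_equiv σ).symm, ?_⟩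
    exact (ciInf_le (Set.finite_range _).bddBelow σ).trans (Real.iSup_le hσ ha)

lemma measurableSet_cball (η : FinConf dim) {a : ℝ} (ha : 0 < a) : MeasurableSet (cball η a) :=
  MeasurableSpace.measurableSet_generateFrom (Or.inr ⟨η, a, ha, rfl⟩)

lemma mem_ofTuple {n : ℕ} {t : Fin n → Space dim} {x : Space dim} :
    x ∈ (ofTuple t).pts ↔ ∃ i, t i = x := by
  simp [ofTuple]

lemma ofTuple_mem_cball_iff {n : ℕ} {t : Fin n → Space dim} {η : FinConf dim} {a : ℝ}
    (ha : 0 ≤ a) :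
    ofTuple t ∈ cball η a ↔ ∃ f : Fin n → η.pts, Function.Surjective f ∧
      (∀ i j, t i = t j ↔ f i = f j) ∧ ∀ i, dist (t i) (f i) ≤ a := by
  rw [mem_cball_iff ha]
  constructor
  · rintro ⟨σ, hσ⟩
    let s : Fin n → (ofTuple t).pts := fun i => ⟨t i, mem_ofTuple.2 ⟨i, rfl⟩⟩
    refine ⟨fun i => σ.symm (s i), ?_, ?_, ?_⟩
    · refine σ.symm.surjective.comp ?_
      rintro ⟨x, hx⟩
      obtain ⟨i, rfl⟩ := mem_ofTuple.1 hx
      exact ⟨i, rfl⟩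
    · intro i j
      simp [s]
    · intro i
      have := hσ (σ.symm (s i))
      simpa [s] using this
  · rintro ⟨f, hf, hij, hd⟩
    choose g hg using hf
    have hinj : Function.Bijective
        (fun x : η.pts => (⟨t (g x), mem_ofTuple.2 ⟨_, rfl⟩⟩ : (ofTuple t).pts)) := by
      constructor
      · intro x y hxy
        have : t (g x) = t (g y) := congrArg Subtype.val hxy
        rw [hij, hg, hg] at this
        exact this
      · rintro ⟨x, hx⟩
        obtain ⟨i, rfl⟩ := mem_ofTuple.1 hx
        refine ⟨f i, Subtype.ext ?_⟩
        exact (hij _ _).2 (hg _)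
    refine ⟨Equiv.ofBijective _ hinj, fun x => ?_⟩
    have := hd (g x)
    rw [hg] at this
    exact this

lemma ofTuple_eq_empty_iff {n : ℕ} {t : Fin n → Space dim} : ofTuple t = empty ↔ n = 0 := by
  simp only [ofTuple, empty, FinConf.mk.injEq, Finset.image_eq_empty]
  constructor
  · intro h
    by_contra hn
    exact (Finset.notMem_empty (⟨0, Nat.pos_of_ne_zero hn⟩ : Fin n)) (h ▸ Finset.mem_univ _)
  · rintro rfl
    rfl

lemma measurable_ofTuple {n : ℕ} :
    Measurable (ofTuple : (Fin n → Space dim) → FinConf dim) := by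
  refine measurable_generateFrom ?_
  rintro B (rfl | ⟨η, a, ha, rfl⟩)
  · have : (ofTuple : (Fin n → Space dim) → FinConf dim) ⁻¹' {empty} = {_t | n = 0} := by
      ext t
      simp [ofTuple_eq_empty_iff]
    rw [this]
    exact MeasurableSet.const _
  · have : (ofTuple : (Fin n → Space dim) → FinConf dim) ⁻¹' (cball η a) =
        ⋃ f : Fin n → η.pts, {t : Fin n → Space dim | Function.Surjective f ∧
          (∀ i j, t i = t j ↔ f i = f j) ∧ ∀ i, dist (t i) (f i : Space dim) ≤ a} := by
      ext t
      simp only [Set.mem_preimage, ofTuple_mem_cball_iff ha.le, Set.mem_iUnion, Set.mem_ofPred_eq]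
    rw [this]
    refine MeasurableSet.iUnion fun f => ?_
    refine (MeasurableSet.const _).inter (MeasurableSet.inter ?_ ?_)
    · change MeasurableSet {t : Fin n → Space dim | ∀ i j, t i = t j ↔ f i = f j}
      rw [Set.ofPred_forall]
      refine MeasurableSet.iInter fun i => ?_
      rw [Set.ofPred_forall]
      refine MeasurableSet.iInter fun j => ?_
      have h1 : MeasurableSet {t : Fin n → Space dim | t i = t j} :=
        measurableSet_eq_fun (measurable_pi_apply i) (measurable_pi_apply j)
      by_cases h : f i = f j
      · simpa [h] using h1
      · simp only [h, iff_false]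
        exact h1.compl
    · change MeasurableSet {t : Fin n → Space dim | ∀ i, dist (t i) (f i : Space dim) ≤ a}
      rw [Set.ofPred_forall]
      refine MeasurableSet.iInter fun i => ?_
      exact measurableSet_le ((measurable_pi_apply i).dist measurable_const) measurable_const

lemma measurable_sym {n : ℕ} : Measurable (sym : Tuple dim n → FinConf dim) :=
  measurable_ofTuple.comp measurable_subtype_coe

lemma sym_mem_cball {n : ℕ} (s t : Tuple dim n) {a : ℝ} (h : dist s t ≤ a) :
    sym t ∈ cball (sym s) a := by
  have ha : 0 ≤ a := dist_nonneg.trans h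
  refine (ofTuple_mem_cball_iff ha).2 ⟨fun i => ⟨s.1 i, mem_ofTuple.2 ⟨i, rfl⟩⟩, ?_, ?_, ?_⟩
  · rintro ⟨x, hx⟩
    obtain ⟨i, rfl⟩ := mem_ofTuple.1 hx
    exact ⟨i, rfl⟩
  · intro i j
    exact t.2.eq_iff.trans (s.2.eq_iff.symm.trans Subtype.mk_eq_mk.symm)
  · intro i
    have h1 : dist (t.1 i) (s.1 i) ≤ dist t.1 s.1 := dist_le_pi_dist _ _ i
    have h2 : dist t.1 s.1 = dist s t := by rw [dist_comm]; rfl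
    exact h1.trans (h2.le.trans h)

lemma continuous_sym {n : ℕ} : Continuous (sym : Tuple dim n → FinConf dim) := by
  refine continuous_def.2 fun U hU => Metric.isOpen_iff.2 fun s hs => ?_
  obtain ⟨a, ha, hsub⟩ := hU (sym s) hs
  exact ⟨a, ha, fun t ht => hsub (sym_mem_cball s t (by
    rw [dist_comm]; exact (Metric.mem_ball.1 ht).le))⟩

lemma exists_sym_eq (η : FinConf dim) : ∃ (n : ℕ) (t : Tuple dim n), sym t = η := by
  refine ⟨η.pts.card, ⟨fun i => (η.pts.equivFin.symm i : Space dim), fun i j h =>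
    η.pts.equivFin.symm.injective (Subtype.ext h)⟩, ?_⟩
  ext x
  simp only [sym, mem_ofTuple]
  constructor
  · rintro ⟨i, rfl⟩
    exact (η.pts.equivFin.symm i).2
  · intro hx
    exact ⟨η.pts.equivFin ⟨x, hx⟩, by simp⟩

lemma eq_of_forall_mem_cball {η ζ : FinConf dim}
    (h : ∀ a : ℝ, 0 < a → ∃ c : FinConf dim, η ∈ cball c a ∧ ζ ∈ cball c a) : η = ζ := by
  have hcard : η.card = ζ.card := by
    obtain ⟨c, h1, h2⟩ := h 1 one_pos
    exact h1.1.trans h2.1.symm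
  ext1
  refine Finset.eq_of_subset_of_card_le (fun x hx => ?_) hcard.ge
  have hcl : x ∈ closure (ζ.pts : Set (Space dim)) := by
    refine Metric.mem_closure_iff.2 fun ε hε => ?_
    obtain ⟨c, h1, h2⟩ := h (ε / 3) (by positivity)
    obtain ⟨σ, hσ⟩ := (mem_cball_iff (by positivity)).1 h1
    obtain ⟨τ, hτ⟩ := (mem_cball_iff (by positivity)).1 h2
    have e1 := hσ (σ.symm ⟨x, hx⟩)
    have e2 := hτ (σ.symm ⟨x, hx⟩)
    rw [Equiv.apply_symm_apply] at e1
    refine ⟨τ (σ.symm ⟨x, hx⟩), (τ (σ.symm ⟨x, hx⟩)).2, ?_⟩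
    have e3 := dist_triangle_right x (τ (σ.symm ⟨x, hx⟩) : Space dim)
      (σ.symm ⟨x, hx⟩ : Space dim)
    have e4 : dist x (σ.symm ⟨x, hx⟩ : Space dim) ≤ ε / 3 := e1
    linarith
  rw [ζ.pts.finite_toSet.isClosed.closure_eq] at hcl
  exact hcl

instance : MeasurableSpace.CountablySeparated (Space dim × FinConf dim) := by
  have hE : MeasurableSpace.CountablySeparated (Space dim) := inferInstance
  obtain ⟨S, hSc, hSm, hS⟩ := hE.countably_separated.exists_countable_separating
  let C : Set (Set (FinConf dim)) :=
    ⋃ n : ℕ, ⋃ s ∈ TopologicalSpace.exists_countable_dense (Tuple dim n) |>.choose,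
      Set.range fun k : ℕ => cball (sym s) (1 / ((k : ℝ) + 1))
  have hCc : C.Countable := by
    refine Set.countable_iUnion fun n => Set.Countable.biUnion
      (TopologicalSpace.exists_countable_dense (Tuple dim n)).choose_spec.1 fun s _ =>
        Set.countable_range _
  refine ⟨⟨(fun s => Prod.fst ⁻¹' s) '' S ∪ (fun s => Prod.snd ⁻¹' s) '' C,
    (hSc.image _).union (hCc.image _), ?_, ?_⟩⟩
  · rintro _ (⟨s, hs, rfl⟩ | ⟨s, hs, rfl⟩)
    · exact measurable_fst (hSm s hs)
    · simp only [C, Set.mem_iUnion] at hs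
      obtain ⟨n, t, -, k, rfl⟩ := hs
      exact measurable_snd (measurableSet_cball _ (by positivity))
  · rintro ⟨x, η⟩ - ⟨y, ζ⟩ - h
    have hxy : x = y := hS x trivial y trivial fun s hs =>
      h _ (Or.inl ⟨s, hs, rfl⟩)
    have hηζ : η = ζ := by
      refine eq_of_forall_mem_cball fun a ha => ?_
      obtain ⟨k, hk⟩ := exists_nat_one_div_lt ha
      obtain ⟨n, t, rfl⟩ := exists_sym_eq η
      have hd := (TopologicalSpace.exists_countable_dense (Tuple dim n)).choose_spec.2
      obtain ⟨s, hs, hst⟩ := Metric.mem_closure_iff.1 (hd t) (1 / ((k : ℝ) + 1)) (by positivity)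
      have hmem : cball (sym s) (1 / ((k : ℝ) + 1)) ∈ C :=
        Set.mem_iUnion.2 ⟨n, Set.mem_iUnion₂.2 ⟨s, hs, ⟨k, rfl⟩⟩⟩
      have h1 : sym t ∈ cball (sym s) (1 / ((k : ℝ) + 1)) :=
        sym_mem_cball s t (by rw [dist_comm]; exact hst.le)
      have h2 : ζ ∈ cball (sym s) (1 / ((k : ℝ) + 1)) :=
        (h _ (Or.inr ⟨_, hmem, rfl⟩)).1 h1
      exact ⟨sym s, ⟨h1.1, h1.2.trans hk.le⟩, ⟨h2.1, h2.2.trans hk.le⟩⟩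
    rw [hxy, hηζ]

lemma isOpen_injective {n : ℕ} :
    IsOpen {t : Fin n → Space dim | Function.Injective t} := by
  have : {t : Fin n → Space dim | Function.Injective t} =
      ⋂ i, ⋂ j, {t : Fin n → Space dim | i = j ∨ t i ≠ t j} := by
    ext t
    simp only [Set.mem_iInter, Set.mem_ofPred_eq, Function.Injective]
    exact forall₂_congr fun i j => by tauto
  rw [this]
  refine isOpen_iInter_of_finite fun i => isOpen_iInter_of_finite fun j => ?_
  by_cases h : i = j
  · simp [h]
  · simp only [h, false_or]
    exact isOpen_ne_fun (continuous_apply i) (continuous_apply j)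

instance {n : ℕ} : PolishSpace (Tuple dim n) := isOpen_injective.polishSpace

/-- Measurability of a function of a point and a configuration can be tested on tuples. -/
lemma measurable_of_sym {Y : Type*} [MeasurableSpace Y] {f : Space dim × FinConf dim → Y}
    (hf : ∀ n, Measurable fun p : Space dim × Tuple dim n => f (p.1, sym p.2)) :
    Measurable f := by
  let _ : MeasurableSpace (Σ n, Space dim × Tuple dim n) := borel _
  have : BorelSpace (Σ n, Space dim × Tuple dim n) := ⟨rfl⟩
  have key : ∀ s : Set (Σ n, Space dim × Tuple dim n),
      (∀ n, MeasurableSet (Sigma.mk n ⁻¹' s)) → MeasurableSet s := by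
    intro s hs
    have : s = ⋃ n, Sigma.mk n '' (Sigma.mk n ⁻¹' s) := by
      ext ⟨n, p⟩
      simp only [Set.mem_preimage, Set.mem_iUnion, Set.mem_image]
      constructor
      · intro h
        exact ⟨n, p, h, rfl⟩
      · rintro ⟨m, q, hq, h⟩
        rw [← h]
        exact hq
    rw [this]
    exact MeasurableSet.iUnion fun n =>
      Topology.IsOpenEmbedding.sigmaMk.measurableEmbedding.measurableSet_image.2 (hs n)
  let F : (Σ n, Space dim × Tuple dim n) → Space dim × FinConf dim := fun q => (q.2.1, sym q.2.2)
  have hF : Measurable F := fun s hs => key _ fun n =>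
    (measurable_fst.prodMk (measurable_sym.comp measurable_snd)) hs
  have hsurj : Function.Surjective F := by
    rintro ⟨x, η⟩
    obtain ⟨n, t, rfl⟩ := exists_sym_eq η
    exact ⟨⟨n, x, t⟩, rfl⟩
  exact (hF.measurable_comp_iff_of_surjective hsurj).1 fun s hs => key _ fun n => hf n hs

lemma measurable_of_sym' {Y : Type*} [MeasurableSpace Y] {f : FinConf dim → Y}
    (hf : ∀ n, Measurable fun t : Tuple dim n => f (sym t)) : Measurable f := by
  have h : Measurable fun p : Space dim × FinConf dim => f p.2 :=
    measurable_of_sym fun n => (hf n).comp measurable_snd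
  exact h.comp (measurable_prodMk_left (x := (0 : Space dim)))

lemma measurable_of_continuous {Y : Type*} [MeasurableSpace Y] [TopologicalSpace Y]
    [BorelSpace Y] {f : Space dim × FinConf dim → Y} (hf : Continuous f) : Measurable f :=
  measurable_of_sym fun _ =>
    (hf.comp (continuous_fst.prodMk (continuous_sym.comp continuous_snd))).measurable

lemma measurable_insert :
    Measurable fun p : Space dim × FinConf dim => insert p.1 p.2 := by
  refine measurable_of_sym fun n => ?_
  have : (fun p : Space dim × Tuple dim n => insert p.1 (sym p.2)) =
      fun p => ofTuple (Fin.cons p.1 p.2.1 : Fin (n + 1) → Space dim) := by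
    funext p
    ext x
    simp only [insert, Finset.mem_insert, sym, mem_ofTuple, Fin.exists_fin_succ, Fin.cons_zero,
      Fin.cons_succ, eq_comm]
  rw [this]
  refine measurable_ofTuple.comp (measurable_pi_iff.2 fun i => ?_)
  refine Fin.cases ?_ (fun j => ?_) i
  · simpa using measurable_fst
  · simp only [Fin.cons_succ]
    exact (measurable_pi_apply j).comp (measurable_subtype_coe.comp measurable_snd)

lemma measurable_sum_erase {g : Space dim × FinConf dim → ℝ≥0∞} (hg : Measurable g)
    {A : Set (FinConf dim)} (hA : MeasurableSet A) :
    Measurable fun η : FinConf dim =>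
      ∑ x ∈ η.pts, g (x, η) * A.indicator 1 (η.erase x) := by
  refine measurable_of_sym' fun n => ?_
  have h1 : (fun t : Tuple dim n => ∑ x ∈ (sym t).pts,
      g (x, sym t) * A.indicator 1 ((sym t).erase x)) =
      fun t => ∑ i : Fin n, g (t.1 i, sym t) * A.indicator 1 ((sym t).erase (t.1 i)) := by
    funext t
    simp only [sym, ofTuple]
    exact Finset.sum_image fun i _ j _ h => t.2 h
  rw [h1]
  refine Finset.measurable_sum _ fun i _ => Measurable.mul ?_ ?_
  · exact hg.comp (((measurable_pi_apply i).comp measurable_subtype_coe).prodMk measurable_sym)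
  · refine (measurable_one.indicator hA).comp ?_
    obtain _ | m := n
    · exact i.elim0
    have : (fun t : Tuple dim (m + 1) => (sym t).erase (t.1 i)) =
        fun t => ofTuple fun j => t.1 (i.succAbove j) := by
      funext t
      ext x
      simp only [erase, Finset.mem_erase, sym, mem_ofTuple]
      constructor
      · rintro ⟨hne, j, rfl⟩
        have hji : j ≠ i := fun h => hne (by rw [h])
        obtain ⟨k, rfl⟩ := Fin.exists_succAbove_eq hji
        exact ⟨k, rfl⟩
      · rintro ⟨k, rfl⟩
        exact ⟨fun h => Fin.succAbove_ne i k (t.2 h), _, rfl⟩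
    rw [this]
    exact measurable_ofTuple.comp (measurable_pi_iff.2 fun j =>
      (measurable_pi_apply _).comp measurable_subtype_coe)

end FinConf

/-! ## The embedded chain of a spatial birth-and-death process -/

/-- The assumptions on the birth rate `b` and the death rate `d`. -/
structure AdmissibleRates {dim : ℕ} (b d : Space dim → FinConf dim → ℝ≥0) : Prop where
  continuous_birth : Continuous fun p : Space dim × FinConf dim => b p.1 p.2
  continuous_death : Continuous fun p : Space dim × FinConf dim => d p.1 p.2
  /-- Sublinear growth of the total birth rate. -/
  sublinear : ∃ c₁ c₂ : ℝ≥0, 0 < c₁ ∧ 0 < c₂ ∧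
    ∀ η : FinConf dim, (∫⁻ x, (b x η : ℝ≥0∞)) ≤ c₁ * (η.card : ℝ≥0∞) + c₂
  /-- The death rate is bounded on configurations with at most `m` points. -/
  death_bounded : ∀ m : ℕ, ∃ M : ℝ≥0, ∀ (x : Space dim) (η : FinConf dim), η.card ≤ m → d x η ≤ M
  /-- The death rate of the points of a configuration is bounded away from zero. -/
  death_pos : ∃ δ : ℝ≥0, 0 < δ ∧ ∀ η : FinConf dim, ∀ x ∈ η.pts, δ ≤ d x η
  /-- Non-degeneracy of the birth rate. -/
  birth_pos : ∃ (r : ℝ) (c₃ : ℝ≥0), 0 < r ∧ 0 < c₃ ∧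
    (∀ (x : Space dim) (η : FinConf dim), (∃ y ∈ η.pts, dist x y ≤ r) → c₃ < b x η) ∧
    ∃ (x₀ : Space dim) (R : ℝ), 0 < R ∧ ∀ x ∈ Metric.ball x₀ R, c₃ < b x FinConf.empty

/-- The jump rate `(B + D)(η) = ∫ b(x, η) dx + ∑_{x ∈ η} d(x, η)`. -/
def totalRate {dim : ℕ} (b d : Space dim → FinConf dim → ℝ≥0) (η : FinConf dim) : ℝ≥0∞ :=
  (∫⁻ x, (b x η : ℝ≥0∞)) + ∑ x ∈ η.pts, (d x η : ℝ≥0∞)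

/-- The transition probability `Q(η, ·)` of the embedded chain: from `η` the chain moves to
`η ∪ {x}` with density `b(x, η) / (B + D)(η)` in `x`, and to `η \ {x}`, `x ∈ η`, with
probability `d(x, η) / (B + D)(η)`. -/
def jumpMeasure {dim : ℕ} (b d : Space dim → FinConf dim → ℝ≥0) (η : FinConf dim) :
    Measure (FinConf dim) :=
  (totalRate b d η)⁻¹ •
    (Measure.map (fun x => FinConf.insert x η) (volume.withDensity fun x => (b x η : ℝ≥0∞)) +
      ∑ x ∈ η.pts, (d x η : ℝ≥0∞) • Measure.dirac (η.erase x))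

namespace AdmissibleRates

variable {dim : ℕ} {b d : Space dim → FinConf dim → ℝ≥0}

lemma measurable_birth (h : AdmissibleRates b d) :
    Measurable fun p : Space dim × FinConf dim => (b p.1 p.2 : ℝ≥0∞) :=
  (FinConf.measurable_of_continuous h.continuous_birth).coe_nnreal_ennreal

lemma measurable_death (h : AdmissibleRates b d) :
    Measurable fun p : Space dim × FinConf dim => (d p.1 p.2 : ℝ≥0∞) :=
  (FinConf.measurable_of_continuous h.continuous_death).coe_nnreal_ennreal

lemma jumpMeasure_apply (η : FinConf dim) {A : Set (FinConf dim)}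
    (hA : MeasurableSet A) :
    jumpMeasure b d η A = (totalRate b d η)⁻¹ *
      ((∫⁻ x, (b x η : ℝ≥0∞) * A.indicator 1 (FinConf.insert x η)) +
        ∑ x ∈ η.pts, (d x η : ℝ≥0∞) * A.indicator 1 (η.erase x)) := by
  have hins : Measurable fun x : Space dim => FinConf.insert x η :=
    FinConf.measurable_insert.comp measurable_prodMk_right
  rw [jumpMeasure, Measure.smul_apply, Measure.add_apply, Measure.map_apply hins hA,
    withDensity_apply _ (hins hA), ← lintegral_indicator (hins hA), Measure.finsetSum_apply,
    smul_eq_mul]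
  congr 2
  · refine lintegral_congr fun x => ?_
    by_cases hx : FinConf.insert x η ∈ A <;> simp [Set.indicator, hx]
  · refine Finset.sum_congr rfl fun x _ => ?_
    rw [Measure.smul_apply, Measure.dirac_apply' _ hA, smul_eq_mul]

lemma measurable_jumpMeasure (h : AdmissibleRates b d) : Measurable (jumpMeasure b d) := by
  refine Measure.measurable_of_measurable_coe _ fun A hA => ?_
  simp only [jumpMeasure_apply _ hA]
  have hb : ∀ {B : Set (FinConf dim)}, MeasurableSet B → Measurable fun η : FinConf dim =>
      ∫⁻ x, (b x η : ℝ≥0∞) * B.indicator 1 (FinConf.insert x η) := fun hB =>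
    Measurable.lintegral_prod_left' (f := fun p : Space dim × FinConf dim =>
        (b p.1 p.2 : ℝ≥0∞) * Set.indicator _ 1 (FinConf.insert p.1 p.2))
      (h.measurable_birth.mul ((measurable_one.indicator hB).comp FinConf.measurable_insert))
  have htot : Measurable (totalRate b d) := by
    have h1 := hb MeasurableSet.univ
    have h2 := FinConf.measurable_sum_erase h.measurable_death MeasurableSet.univ
    have h3 := h1.add h2
    simp only [Set.indicator_univ, Pi.one_apply, mul_one] at h3
    exact h3
  exact htot.inv.mul ((hb hA).add (FinConf.measurable_sum_erase h.measurable_death hA))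

lemma totalRate_ne_top (h : AdmissibleRates b d) (η : FinConf dim) : totalRate b d η ≠ ∞ := by
  obtain ⟨c₁, c₂, -, -, hc⟩ := h.sublinear
  refine ENNReal.add_ne_top.2 ⟨ne_top_of_le_ne_top ?_ (hc η), ?_⟩
  · exact ENNReal.add_ne_top.2
      ⟨ENNReal.mul_ne_top ENNReal.coe_ne_top (ENNReal.natCast_ne_top _), ENNReal.coe_ne_top⟩
  · exact ENNReal.sum_ne_top.2 fun _ _ => ENNReal.coe_ne_top

lemma totalRate_ne_zero (h : AdmissibleRates b d) (η : FinConf dim) : totalRate b d η ≠ 0 := by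
  intro h0
  obtain ⟨hB, hD⟩ := add_eq_zero.1 h0
  have hne : η.pts = ∅ := by
    refine Finset.eq_empty_of_forall_notMem fun x hx => ?_
    obtain ⟨δ, hδ, hd⟩ := h.death_pos
    have h1 := (Finset.sum_eq_zero_iff.1 hD) x hx
    have h2 := hd η x hx
    rw [ENNReal.coe_eq_zero.1 h1] at h2
    exact absurd hδ (not_lt.2 h2)
  obtain rfl : η = FinConf.empty := FinConf.ext hne
  obtain ⟨r, c₃, -, hc, -, x₀, R, hR, hball⟩ := h.birth_pos
  have h1 : ∫⁻ _ in Metric.ball x₀ R, (c₃ : ℝ≥0∞) ≤ ∫⁻ x, (b x FinConf.empty : ℝ≥0∞) :=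
    (setLIntegral_mono' measurableSet_ball fun x hx => ENNReal.coe_le_coe.2 (hball x hx).le).trans
      (setLIntegral_le_lintegral _ _)
  rw [hB, setLIntegral_const, nonpos_iff_eq_zero, mul_eq_zero] at h1
  rcases h1 with h1 | h1
  · exact hc.ne' (ENNReal.coe_eq_zero.1 h1)
  · exact (Metric.measure_ball_pos volume x₀ hR).ne' h1

/-- The transition kernel `Q` of the embedded Markov chain. -/
def jumpKernel (h : AdmissibleRates b d) : Kernel (FinConf dim) (FinConf dim) where
  toFun := jumpMeasure b d
  measurable' := h.measurable_jumpMeasure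

instance (h : AdmissibleRates b d) : IsMarkovKernel h.jumpKernel := by
  refine ⟨fun η => ⟨?_⟩⟩
  change jumpMeasure b d η Set.univ = 1
  rw [jumpMeasure_apply η MeasurableSet.univ]
  simpa [totalRate] using ENNReal.inv_mul_cancel (h.totalRate_ne_zero η) (h.totalRate_ne_top η)

end AdmissibleRates

end

/-! ### Reachability for a general Markov kernel -/

section MarkovChain

/-! Only the positivity of one-step probabilities matters. Suppose `λ(A) > 0`, and let `U` be the
set of configurations that lead to `A` in some number `n ≥ 0` of steps; it contains its own
predecessors. Deaths have positive rate, so `U` is stable under adding points, and it remains to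
find `∅` in `U`. Some layer of `n`-tuples meets `U` in positive volume. By Tonelli it suffices to
descend one point at a time: if the set `G` of `x` with `η ∪ {x} ∈ U` has positive volume, then `η ∈
U` (`mem_of_volume_insert_pos`). Indeed, from `η ∪ {y}` births occur throughout the `r`-ball at `y`,
so `y ∈ G` as soon as `G` has positive volume in that ball. Hence the interior of `G` is nonempty
and clopen, and `G` is the whole space (`insert_mem_of_volume_pos`).

Conversely, a `λ`-null set is entered in one step only from a `λ`-null set
(`lebesguePoisson_jumpKernel_pos_eq_zero`), hence also in `n` steps. As `∅` is an atom of `λ`, the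
chain started at `∅` almost surely never enters a null set. -/

lemma measure_iUnion_pos_iff {X ι : Type*} [MeasurableSpace X] [Countable ι] {μ : Measure X}
    {s : ι → Set X} : 0 < μ (⋃ i, s i) ↔ ∃ i, 0 < μ (s i) := by
  simp [pos_iff_ne_zero, measure_iUnion_null_iff]

variable {X : Type*} [MeasurableSpace X] {P : Kernel X X}

/-- The points from which the chain enters `A` in exactly `n` steps with positive probability. -/
def reachSet (P : Kernel X X) (A : Set X) : ℕ → Set X
  | 0 => A
  | n + 1 => {x | 0 < P x (reachSet P A n)}

lemma measurableSet_reachSet {A : Set X} (hA : MeasurableSet A) (n : ℕ) :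
    MeasurableSet (reachSet P A n) := by
  induction n with
  | zero => exact hA
  | succ n ih => exact measurableSet_lt measurable_const (P.measurable_coe ih)

/-- The definition splits off the first step, `chainLaw_coord_succ` the last; this reconciles the
two. -/
lemma reachSet_succ' (A : Set X) (n : ℕ) :
    reachSet P A (n + 1) = reachSet P {x | 0 < P x A} n := by
  induction n with
  | zero => rfl
  | succ n ih =>
    change {x | 0 < P x (reachSet P A (n + 1))} = _
    rw [ih]
    rfl

/-- If the kernel preserves null sets of `ψ`, then almost no point leads to a given null set. -/
lemma measure_reachSet_eq_zero {ψ : Measure X} {A : Set X} (hA : MeasurableSet A)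
    (h : ∀ B, MeasurableSet B → ψ B = 0 → ψ {x | 0 < P x B} = 0) (h0 : ψ A = 0) (n : ℕ) :
    ψ (reachSet P A n) = 0 := by
  induction n with
  | zero => exact h0
  | succ n ih => exact h _ (measurableSet_reachSet hA n) ih

variable [IsMarkovKernel P]

/-- The law of the chain at time `n + 1` is the law at time `n` pushed through the kernel. -/
lemma chainLaw_coord_succ (μ : Measure X) [IsProbabilityMeasure μ] (n : ℕ) {A : Set X}
    (hA : MeasurableSet A) :
    chainLaw P μ {Φ | Φ (n + 1) ∈ A} = ∫⁻ Φ, P (Φ n) A ∂chainLaw P μ := by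
  have key := Kernel.map_frestrictLe_trajMeasure_compProd_eq_map_trajMeasure
    (X := fun _ => X) (μ₀ := μ) (a := n)
    (κ := fun n => P.comap (fun h : (i : Finset.Iic n) → X => h ⟨n, Finset.mem_Iic.2 le_rfl⟩)
      (measurable_pi_apply _))
  -- Test the joint law of the history up to time `n` and the next state on an event about the next
  -- state alone.
  have h1 := DFunLike.congr_fun key (Prod.snd ⁻¹' A)
  rw [Measure.map_apply (by fun_prop) (measurable_snd hA),
    Measure.compProd_apply (measurable_snd hA), lintegral_map] at h1
  · exact h1.symm
  · exact Kernel.measurable_kernel_prodMk_left (measurable_snd hA)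
  · fun_prop

lemma chainLaw_coord_zero (μ : Measure X) [IsProbabilityMeasure μ] {A : Set X}
    (hA : MeasurableSet A) :
    chainLaw P μ {Φ | Φ 0 ∈ A} = μ A := by
  have hm : MeasurableSet {Φ : ℕ → X | Φ 0 ∈ A} := measurable_pi_apply 0 hA
  have hS : MeasurableSet {y : (i : Finset.Iic 0) → X | y ⟨0, Finset.mem_Iic.2 le_rfl⟩ ∈ A} :=
    measurable_pi_apply _ hA
  have h0 : {Φ : ℕ → X | Φ 0 ∈ A} = Preorder.frestrictLe 0 ⁻¹'
      {y : (i : Finset.Iic 0) → X | y ⟨0, Finset.mem_Iic.2 le_rfl⟩ ∈ A} := rfl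
  rw [chainLaw, Kernel.trajMeasure, Measure.bind_apply hm (Kernel.aemeasurable _)]
  have h2 : ∀ y : (i : Finset.Iic 0) → X, Kernel.traj (X := fun _ => X) (fun n =>
      P.comap (fun h : (i : Finset.Iic n) → X => h ⟨n, Finset.mem_Iic.2 le_rfl⟩)
      (measurable_pi_apply _)) 0 y {Φ : ℕ → X | Φ 0 ∈ A} =
      Set.indicator {y : (i : Finset.Iic 0) → X | y ⟨0, Finset.mem_Iic.2 le_rfl⟩ ∈ A} 1 y := by
    intro y
    rw [h0, ← Measure.map_apply (by fun_prop) hS, Kernel.traj_map_frestrictLe_apply,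
      Kernel.partialTraj_self, Kernel.id_apply, Measure.dirac_apply' _ hS]
  simp_rw [h2]
  rw [lintegral_indicator_one hS, Measure.map_apply (by fun_prop) hS]
  rfl

lemma chainLaw_coord_pos_iff (x : X) (n : ℕ) {A : Set X} (hA : MeasurableSet A) :
    0 < chainLaw P (Measure.dirac x) {Φ | Φ n ∈ A} ↔ x ∈ reachSet P A n := by
  induction n generalizing A with
  | zero =>
    rw [chainLaw_coord_zero _ hA, Measure.dirac_apply' _ hA]
    by_cases hx : x ∈ A <;> simp [reachSet, hx]
  | succ n ih =>
    have hA' : MeasurableSet {x | 0 < P x A} :=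
      measurableSet_lt measurable_const (P.measurable_coe hA)
    have hm : Measurable fun Φ : ℕ → X => P (Φ n) A :=
      (P.measurable_coe hA).comp (measurable_pi_apply n)
    rw [reachSet_succ', ← ih hA', chainLaw_coord_succ _ _ hA, lintegral_pos_iff_support hm]
    simp only [Function.support, pos_iff_ne_zero]
    rfl

lemma returnProb_pos_iff (x : X) {A : Set X} (hA : MeasurableSet A) :
    0 < returnProb P x A ↔ ∃ n, x ∈ reachSet P A (n + 1) := by
  have h1 : {Φ : ℕ → X | ∃ n, 1 ≤ n ∧ Φ n ∈ A} = ⋃ n : ℕ, {Φ | Φ (n + 1) ∈ A} := by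
    ext Φ
    simp only [Set.mem_iUnion, Set.mem_ofPred_eq]
    constructor
    · rintro ⟨_ | n, hn, h⟩
      · omega
      · exact ⟨n, h⟩
    · rintro ⟨n, h⟩
      exact ⟨n + 1, by omega, h⟩
  rw [returnProb, h1, measure_iUnion_pos_iff]
  exact exists_congr fun n => chainLaw_coord_pos_iff x (n + 1) hA

/-- A set is closed under predecessors if it contains every point from which it is entered in one
step with positive probability. If every such set containing `A` is everything, then the chain
enters `A` from everywhere. -/
lemma returnProb_pos_of_forall_closed {A : Set X} (hA : MeasurableSet A)
    (h : ∀ U : Set X, MeasurableSet U → A ⊆ U → (∀ x, 0 < P x U → x ∈ U) → U = Set.univ) (x : X) :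
    0 < returnProb P x A := by
  have hpos : ∀ x, 0 < P x (⋃ n, reachSet P A n) → ∃ n, x ∈ reachSet P A (n + 1) := fun x hx =>
    measure_iUnion_pos_iff.1 hx
  have hU := h (⋃ n, reachSet P A n) (.iUnion fun n => measurableSet_reachSet hA n)
    (Set.subset_iUnion (reachSet P A) 0)
    fun x hx => Set.mem_iUnion.2 ((hpos x hx).imp' (· + 1) fun _ => id)
  -- Membership of `x` in the union could come from time `0`, which does not count as a return.
  -- Taking one step first, into a set of full probability, gives a time `n + 1`.
  refine (returnProb_pos_iff x hA).2 (hpos x ?_)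
  rw [hU, measure_univ]
  exact one_pos

end MarkovChain

/-! ### Configurations and the Lebesgue–Poisson measure -/

namespace FinConf

variable {dim : ℕ}

lemma mem_insert_pts {x y : Space dim} {η : FinConf dim} :
    x ∈ (insert y η).pts ↔ x = y ∨ x ∈ η.pts := by
  simp [insert]

lemma mem_erase_pts {x y : Space dim} {η : FinConf dim} :
    x ∈ (η.erase y).pts ↔ x ≠ y ∧ x ∈ η.pts := by
  simp [erase]

lemma insert_comm (x y : Space dim) (η : FinConf dim) :
    insert x (insert y η) = insert y (insert x η) := by
  ext z
  simp only [mem_insert_pts]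
  tauto

lemma insert_eq_self {x : Space dim} {η : FinConf dim} (hx : x ∈ η.pts) : insert x η = η := by
  ext z
  simp only [mem_insert_pts]
  exact ⟨fun h => h.elim (fun h => h ▸ hx) id, Or.inr⟩

lemma erase_insert {x : Space dim} {η : FinConf dim} (hx : x ∉ η.pts) :
    (insert x η).erase x = η := by
  ext z
  simp only [mem_insert_pts, mem_erase_pts]
  exact ⟨fun h => h.2.resolve_left h.1, fun h => ⟨fun e => hx (e ▸ h), Or.inr h⟩⟩

lemma ofTuple_cons {n : ℕ} (x : Space dim) (t : Fin n → Space dim) :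
    ofTuple (Fin.cons x t : Fin (n + 1) → Space dim) = insert x (ofTuple t) := by
  ext z
  simp only [mem_insert_pts, mem_ofTuple, Fin.exists_fin_succ, Fin.cons_zero, Fin.cons_succ,
    eq_comm]

lemma erase_ofTuple {n : ℕ} {t : Fin (n + 1) → Space dim} (ht : Function.Injective t)
    (i : Fin (n + 1)) : (ofTuple t).erase (t i) = ofTuple (i.removeNth t) := by
  ext z
  simp only [mem_erase_pts, mem_ofTuple, Fin.removeNth]
  constructor
  · rintro ⟨hne, j, rfl⟩
    obtain ⟨k, rfl⟩ := Fin.exists_succAbove_eq (x := j) (y := i) fun h => hne (by rw [h])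
    exact ⟨k, rfl⟩
  · rintro ⟨k, rfl⟩
    exact ⟨fun h => Fin.succAbove_ne i k (ht h), _, rfl⟩

lemma card_ofTuple {n : ℕ} {t : Fin n → Space dim} (ht : Function.Injective t) :
    (ofTuple t).card = n := by
  simp [card, ofTuple, Finset.card_image_of_injective _ ht]

@[elab_as_elim]
lemma induction_insert {p : FinConf dim → Prop} (empty : p empty)
    (insert : ∀ x η, p η → p (insert x η)) (η : FinConf dim) : p η := by
  classical
  obtain ⟨s⟩ := η
  induction s using Finset.induction_on with
  | empty => exact empty
  | insert x s _ ih =>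
    convert insert x _ ih
    simp [FinConf.insert]

/-! ### Null sets of tuples -/

/-- Tonelli with coordinate `0` split off. It links consecutive layers in both directions of the
theorem. -/
lemma volume_eq_zero_iff_ae_cons {E : Type*} [MeasureSpace E] [SigmaFinite (volume : Measure E)]
    {n : ℕ} {S : Set (Fin (n + 1) → E)} (hS : MeasurableSet S) :
    volume S = 0 ↔ ∀ᵐ t : Fin n → E, volume {x : E | (Fin.cons x t : Fin (n + 1) → E) ∈ S} = 0 := by
  have e := (volume_preserving_piFinSuccAbove (fun _ : Fin (n + 1) => E) 0).symm
  rw [← e.measure_preimage_equiv, Measure.volume_eq_prod,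
    Measure.prod_apply_symm (e.measurable hS),
    lintegral_eq_zero_iff (measurable_measure_prodMk_right (e.measurable hS))]
  refine Filter.eventually_congr (.of_forall fun t => ?_)
  simp [Set.preimage, Fin.insertNthEquiv, MeasurableEquiv.piFinSuccAbove_symm_apply]

lemma volume_removeNth_preimage_eq_zero {E : Type*} [MeasureSpace E]
    [SigmaFinite (volume : Measure E)] {n : ℕ} (i : Fin (n + 1)) {S : Set (Fin n → E)}
    (hS : volume S = 0) : volume {t : Fin (n + 1) → E | i.removeNth t ∈ S} = 0 := by
  have e := volume_preserving_piFinSuccAbove (fun _ : Fin (n + 1) => E) i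
  exact (Measure.quasiMeasurePreserving_snd.comp e.quasiMeasurePreserving).preimage_null hS

/-- Each diagonal `t i = t j` is a linear subspace, proper because the dimension is positive, hence
null. -/
lemma ae_injective (hdim : 1 ≤ dim) (n : ℕ) :
    ∀ᵐ t : Fin n → Space dim, Function.Injective t := by
  have hne : ∀ i j : Fin n, i ≠ j → ∀ᵐ t : Fin n → Space dim, t i ≠ t j := by
    intro i j hij
    let K : Submodule ℝ (Fin n → Space dim) :=
      LinearMap.ker ((LinearMap.proj i : (Fin n → Space dim) →ₗ[ℝ] Space dim) - LinearMap.proj j)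
    have hK : K ≠ ⊤ := by
      intro htop
      let v : Space dim := EuclideanSpace.single ⟨0, hdim⟩ 1
      have hv : Pi.single i v ∈ K := by rw [htop]; trivial
      have hv0 : v = 0 := by
        simpa [K, hij.symm, sub_eq_zero] using hv
      simp [v] at hv0
    have h0 := Measure.addHaar_submodule (volume : Measure (Fin n → Space dim)) K hK
    refine measure_mono_null (fun t ht => ?_) h0
    simpa [K, sub_eq_zero] using ht
  have h1 : ∀ᵐ t : Fin n → Space dim, ∀ i j : Fin n, i ≠ j → t i ≠ t j := by
    simp only [ae_all_iff]
    exact hne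
  filter_upwards [h1] with t ht i j hij
  by_contra h
  exact ht i j h hij

/-- The diagonals being null, the restriction to distinct points disappears and Tonelli applies on
full product spaces. -/
lemma lebesguePoisson_apply (hdim : 1 ≤ dim) {A : Set (FinConf dim)} (hA : MeasurableSet A) :
    lebesguePoisson dim A =
      ∑' n : ℕ, ((n ! : ℕ) : ℝ≥0∞)⁻¹ * volume {t : Fin n → Space dim | ofTuple t ∈ A} := by
  rw [lebesguePoisson, Measure.sum_apply _ hA]
  refine tsum_congr fun n => ?_
  have hinj : ∀ᵐ t : Fin n → Space dim, t ∈ {t : Fin n → Space dim | Function.Injective t} :=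
    ae_injective hdim n
  rw [Measure.restrict_eq_self_of_ae_mem hinj, Measure.smul_apply,
    Measure.map_apply measurable_ofTuple hA]
  rfl

lemma lebesguePoisson_eq_zero_iff (hdim : 1 ≤ dim) {A : Set (FinConf dim)}
    (hA : MeasurableSet A) :
    lebesguePoisson dim A = 0 ↔ ∀ n : ℕ, volume {t : Fin n → Space dim | ofTuple t ∈ A} = 0 := by
  simp [lebesguePoisson_apply hdim hA, ENNReal.tsum_eq_zero]

/-- The layer `n = 0` is a single point of nonzero volume, so `∅` is an atom. -/
lemma lebesguePoisson_ne_zero_of_empty_mem (hdim : 1 ≤ dim) {A : Set (FinConf dim)}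
    (hA : MeasurableSet A) (h : empty ∈ A) : lebesguePoisson dim A ≠ 0 := by
  intro h0
  have h1 := (lebesguePoisson_eq_zero_iff hdim hA).1 h0 0
  have h2 : {t : Fin 0 → Space dim | ofTuple t ∈ A} = Set.univ := by
    ext t
    simpa [ofTuple_eq_empty_iff.2 rfl] using h
  rw [h2] at h1
  exact NeZero.ne _ (Measure.measure_univ_eq_zero.1 h1)

lemma measurable_card : Measurable (card : FinConf dim → ℕ) :=
  measurable_of_sym' fun n => by
    simp only [sym, card_ofTuple (Subtype.prop _), measurable_const]

lemma measurable_sum_enorm :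
    Measurable fun η : FinConf dim => ∑ x ∈ η.pts, ‖x‖ₑ := by
  have h := measurable_sum_erase (dim := dim) (g := fun p => ‖p.1‖ₑ) (by fun_prop)
    MeasurableSet.univ
  simpa using h

lemma sigmaFinite_lebesguePoisson (hdim : 1 ≤ dim) : SigmaFinite (lebesguePoisson dim) := by
  -- Bounding the cardinality leaves finitely many layers; bounding the sum of norms, which is
  -- measurable, puts each layer inside a ball.
  let S : ℕ → Set (FinConf dim) := fun k => {η | η.card ≤ k ∧ ∑ x ∈ η.pts, ‖x‖ₑ ≤ k}
  have hS : ∀ k, MeasurableSet (S k) := fun k =>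
    (measurableSet_le measurable_card measurable_const).inter
      (measurableSet_le measurable_sum_enorm measurable_const)
  refine ⟨⟨⟨S, fun _ => trivial, fun k => ?_, ?_⟩⟩⟩
  · rw [lebesguePoisson_apply hdim (hS k), tsum_eq_sum (s := Finset.range (k + 1))]
    · refine ENNReal.sum_lt_top.2 fun n _ => ENNReal.mul_lt_top ?_ ?_
      · exact ENNReal.inv_lt_top.2 (by exact_mod_cast n.factorial_pos)
      · refine (measure_mono fun t ht => ?_).trans_lt
          (measure_closedBall_lt_top (x := (0 : Fin n → Space dim)) (r := k))
        rw [mem_closedBall_zero_iff, pi_norm_le_iff_of_nonneg k.cast_nonneg]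
        intro i
        have h1 : ‖t i‖ₑ ≤ ∑ x ∈ (ofTuple t).pts, ‖x‖ₑ :=
          Finset.single_le_sum (f := fun x : Space dim => ‖x‖ₑ) (fun _ _ => zero_le)
            (mem_ofTuple.2 ⟨i, rfl⟩)
        have h2 := h1.trans ht.2
        rw [← ofReal_norm, ← ENNReal.ofReal_natCast,
          ENNReal.ofReal_le_ofReal_iff k.cast_nonneg] at h2
        exact h2
    · intro n hn
      have h0 : volume {t : Fin n → Space dim | ofTuple t ∈ S k} = 0 := by
        refine measure_mono_null (fun t ht => ?_) (ae_iff.1 (ae_injective hdim n))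
        intro hinj
        refine hn ?_
        have h1 := ht.1
        rw [card_ofTuple hinj] at h1
        exact Finset.mem_range.2 (by omega)
      rw [h0, mul_zero]
  · refine Set.eq_univ_of_forall fun η => Set.mem_iUnion.2 ?_
    have hfin : ∑ x ∈ η.pts, ‖x‖ₑ ≠ ∞ := ENNReal.sum_ne_top.2 fun x _ => enorm_ne_top
    obtain ⟨m, hm⟩ := ENNReal.exists_nat_gt hfin
    exact ⟨max η.card m, le_max_left _ _,
      hm.le.trans (by exact_mod_cast le_max_right η.card m)⟩

end FinConf

/-! ### One-step transitions of the birth-and-death chain -/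

namespace AdmissibleRates

variable {dim : ℕ} {b d : Space dim → FinConf dim → ℝ≥0}

/-- The total rate is finite, so normalizing does not affect positivity. Points of `η` have positive
death rate, whereas the birth rate may vanish and must stay in the condition. -/
lemma jumpKernel_apply_pos_iff (h : AdmissibleRates b d) (η : FinConf dim) {A : Set (FinConf dim)}
    (hA : MeasurableSet A) :
    0 < h.jumpKernel η A ↔ 0 < volume {x | 0 < b x η ∧ FinConf.insert x η ∈ A} ∨
      ∃ x ∈ η.pts, η.erase x ∈ A := by
  have hmeas : Measurable fun x => (b x η : ℝ≥0∞) * A.indicator 1 (FinConf.insert x η) :=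
    (h.measurable_birth.comp measurable_prodMk_right).mul
      ((measurable_one.indicator hA).comp
        (FinConf.measurable_insert.comp measurable_prodMk_right))
  have hsupp : (Function.support fun x => (b x η : ℝ≥0∞) * A.indicator 1 (FinConf.insert x η)) =
      {x | 0 < b x η ∧ FinConf.insert x η ∈ A} := by
    ext x
    by_cases hx : FinConf.insert x η ∈ A <;> simp [hx, pos_iff_ne_zero]
  obtain ⟨δ, hδ, hd⟩ := h.death_pos
  change 0 < jumpMeasure b d η A ↔ _
  rw [jumpMeasure_apply η hA, ENNReal.mul_pos_iff, add_pos_iff, lintegral_pos_iff_support hmeas,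
    hsupp]
  refine ⟨fun h1 => h1.2.imp id fun h2 => ?_, fun h1 =>
    ⟨ENNReal.inv_pos.2 (h.totalRate_ne_top η), h1.imp id ?_⟩⟩
  · obtain ⟨x, hx, hne⟩ := Finset.exists_ne_zero_of_sum_ne_zero h2.ne'
    refine ⟨x, hx, ?_⟩
    by_contra hxA
    simp [hxA] at hne
  · rintro ⟨x, hx, hxA⟩
    refine lt_of_lt_of_le ?_ (Finset.single_le_sum (fun _ _ => zero_le) hx)
    simpa [hxA] using hδ.trans_le (hd η x hx)

/-- Almost every configuration has zero probability to jump into a given null set. -/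
lemma lebesguePoisson_jumpKernel_pos_eq_zero (hdim : 1 ≤ dim) (h : AdmissibleRates b d)
    {A : Set (FinConf dim)} (hA : MeasurableSet A) (h0 : FinConf.lebesguePoisson dim A = 0) :
    FinConf.lebesguePoisson dim {η | 0 < h.jumpKernel η A} = 0 := by
  rw [FinConf.lebesguePoisson_eq_zero_iff hdim hA] at h0
  rw [FinConf.lebesguePoisson_eq_zero_iff hdim
    (measurableSet_lt measurable_const (h.jumpKernel.measurable_coe hA))]
  intro n
  -- Births into `A` are controlled by the layer above, deaths by the layer below.
  have hbirth := (FinConf.volume_eq_zero_iff_ae_cons (FinConf.measurable_ofTuple hA)).1 (h0 (n + 1))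
  have hdeath : ∀ᵐ t : Fin n → Space dim, ∀ x ∈ (FinConf.ofTuple t).pts,
      (FinConf.ofTuple t).erase x ∉ A := by
    cases n with
    | zero => exact .of_forall fun t x hx => (FinConf.mem_ofTuple.1 hx).elim fun i => i.elim0
    | succ m =>
      have h1 : ∀ᵐ t : Fin (m + 1) → Space dim, ∀ i : Fin (m + 1),
          FinConf.ofTuple (i.removeNth t) ∉ A := ae_all_iff.2 fun i => by
        have := FinConf.volume_removeNth_preimage_eq_zero i (h0 m)
        rw [ae_iff]
        simpa only [not_not, Set.mem_ofPred_eq] using this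
      filter_upwards [h1, FinConf.ae_injective hdim (m + 1)] with t ht hinj x hx
      obtain ⟨i, rfl⟩ := FinConf.mem_ofTuple.1 hx
      rw [FinConf.erase_ofTuple hinj]
      exact ht i
  have hae : ∀ᵐ t : Fin n → Space dim, ¬ 0 < h.jumpKernel (FinConf.ofTuple t) A := by
    filter_upwards [hbirth, hdeath] with t hb hd
    rw [h.jumpKernel_apply_pos_iff _ hA]
    rintro (h1 | ⟨x, hx, hxA⟩)
    · refine h1.ne' (measure_mono_null (fun x hx => ?_) hb)
      change FinConf.ofTuple _ ∈ A
      rw [FinConf.ofTuple_cons]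
      exact hx.2
    · exact hd x hx hxA
  rw [ae_iff] at hae
  simpa only [not_not, Set.mem_ofPred_eq] using hae

/-! ### Sets closed under predecessors -/

section Closed

variable {U : Set (FinConf dim)}

/-- The death of an added point leads back to `η`, so the larger configuration is a predecessor. -/
lemma insert_mem_of_mem (h : AdmissibleRates b d) (hU : MeasurableSet U)
    (hcl : ∀ η, 0 < h.jumpKernel η U → η ∈ U) {η : FinConf dim} (hη : η ∈ U) (x : Space dim) :
    FinConf.insert x η ∈ U := by
  by_cases hx : x ∈ η.pts
  · rwa [FinConf.insert_eq_self hx]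
  · refine hcl _ ((h.jumpKernel_apply_pos_iff _ hU).2 (Or.inr
      ⟨x, FinConf.mem_insert_pts.2 (Or.inl rfl), ?_⟩))
    rwa [FinConf.erase_insert hx]

/-- If adding a point leads into `U` for a set of points of positive volume, then it does so for
every point: the set of such points can be enlarged by `r` at a time. -/
lemma insert_mem_of_volume_pos (h : AdmissibleRates b d) (hU : MeasurableSet U)
    (hcl : ∀ η, 0 < h.jumpKernel η U → η ∈ U) {η : FinConf dim}
    (hη : 0 < volume {x | FinConf.insert x η ∈ U}) (y : Space dim) :
    FinConf.insert y η ∈ U := by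
  obtain ⟨r, c₃, hr, hc, hb, -⟩ := h.birth_pos
  set G : Set (Space dim) := {x | FinConf.insert x η ∈ U}
  -- From `η ∪ {y}`, a birth at `x` in this intersection has positive rate and gives `η ∪ {x, y}`,
  -- which is in `U` because `η ∪ {x}` is.
  have hspread : ∀ y, 0 < volume (G ∩ Metric.ball y r) → y ∈ G := by
    intro y hy
    refine hcl _ ((h.jumpKernel_apply_pos_iff _ hU).2 (Or.inl
      (hy.trans_le (measure_mono fun x hx => ⟨hc.trans (hb x _ ⟨y, ?_, ?_⟩), ?_⟩))))
    · exact FinConf.mem_insert_pts.2 (Or.inl rfl)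
    · exact (Metric.mem_ball.1 hx.2).le
    · rw [FinConf.insert_comm]
      exact h.insert_mem_of_mem hU hcl hx.1 y
  -- A set of positive measure has a point near which it is everywhere of positive measure. Radius
  -- `r / 2` keeps `ball z (r / 2)` inside `ball y r` for all `y` near `z`.
  obtain ⟨z, -, hz⟩ := exists_mem_forall_mem_nhdsWithin_pos_measure hη.ne'
  have hzG : z ∈ interior G := by
    refine mem_interior_iff_mem_nhds.2 (Filter.mem_of_superset
      (Metric.ball_mem_nhds z (half_pos hr)) fun y hy => hspread y ?_)
    refine (hz _ (inter_mem_nhdsWithin G (Metric.ball_mem_nhds z (half_pos hr)))).trans_le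
      (measure_mono fun x hx => ⟨hx.1, ?_⟩)
    have h1 := Metric.mem_ball.1 hx.2
    have h2 := Metric.mem_ball.1 hy
    have h3 := dist_triangle_right x y z
    exact Metric.mem_ball.2 (by linarith)
  -- A limit point `w` has an interior point `v` of `G` within `r / 2`. For `y` within `r / 2` of
  -- `w`, the ball `ball y r` contains `v`, hence a nonempty open part of `G`.
  have hclosed : IsClosed (interior G) := by
    refine isClosed_of_closure_subset fun w hw => ?_
    obtain ⟨v, hv, hwv⟩ := Metric.mem_closure_iff.1 hw (r / 2) (half_pos hr)
    refine mem_interior_iff_mem_nhds.2 (Filter.mem_of_superset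
      (Metric.ball_mem_nhds w (half_pos hr)) fun y hy => hspread y ?_)
    have hvy : v ∈ Metric.ball y r := by
      have h2 := Metric.mem_ball.1 hy
      have h3 := dist_triangle_left v y w
      rw [dist_comm y w] at h2
      exact Metric.mem_ball.2 (by linarith)
    exact ((isOpen_interior.inter Metric.isOpen_ball).measure_pos volume ⟨v, hv, hvy⟩).trans_le
      (measure_mono (Set.inter_subset_inter_left _ interior_subset))
  have huniv : interior G = Set.univ :=
    IsClopen.eq_univ ⟨hclosed, isOpen_interior⟩ ⟨z, hzG⟩
  have hy : y ∈ interior G := huniv ▸ Set.mem_univ y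
  exact (interior_subset hy : y ∈ G)

/-- Once every added point leads into `U`, a nonempty `η` can add one of its own points. The empty
one has none, and uses births in the ball where `b(·, ∅)` is positive. -/
lemma mem_of_volume_insert_pos (h : AdmissibleRates b d) (hU : MeasurableSet U)
    (hcl : ∀ η, 0 < h.jumpKernel η U → η ∈ U) {η : FinConf dim}
    (hη : 0 < volume {x | FinConf.insert x η ∈ U}) : η ∈ U := by
  have hall := h.insert_mem_of_volume_pos hU hcl hη
  rcases η.pts.eq_empty_or_nonempty with he | ⟨y, hy⟩
  · obtain rfl : η = FinConf.empty := FinConf.ext he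
    obtain ⟨r, c₃, -, hc, -, x₀, R, hR, hball⟩ := h.birth_pos
    exact hcl _ ((h.jumpKernel_apply_pos_iff _ hU).2 (Or.inl
      ((Metric.measure_ball_pos volume x₀ hR).trans_le
        (measure_mono fun x hx => ⟨hc.trans (hball x hx), hall x⟩))))
  · rw [← FinConf.insert_eq_self hy]
    exact hall y

/-- Descent on the number of points: if layer `n` were null in `U`, almost every slice of layer `n +
1` would be null too, and Tonelli would make that layer null. -/
lemma empty_mem_of_volume_pos (h : AdmissibleRates b d) (hU : MeasurableSet U)
    (hcl : ∀ η, 0 < h.jumpKernel η U → η ∈ U) {n : ℕ}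
    (hn : volume {t : Fin n → Space dim | FinConf.ofTuple t ∈ U} ≠ 0) : FinConf.empty ∈ U := by
  induction n with
  | zero =>
    obtain ⟨t, ht⟩ := nonempty_of_measure_ne_zero hn
    rwa [← FinConf.ofTuple_eq_empty_iff.2 rfl]
  | succ n ih =>
    refine ih fun h0 => hn
      ((FinConf.volume_eq_zero_iff_ae_cons (FinConf.measurable_ofTuple hU)).2 ?_)
    refine measure_mono_null (fun t ht => ?_) h0
    refine h.mem_of_volume_insert_pos hU hcl (pos_iff_ne_zero.2 fun h1 => ht ?_)
    change volume {x | FinConf.ofTuple _ ∈ U} = 0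
    simpa only [FinConf.ofTuple_cons] using h1

lemma eq_univ_of_lebesguePoisson_pos (hdim : 1 ≤ dim) (h : AdmissibleRates b d)
    (hU : MeasurableSet U) (hcl : ∀ η, 0 < h.jumpKernel η U → η ∈ U)
    (hpos : 0 < FinConf.lebesguePoisson dim U) : U = Set.univ := by
  have h1 := mt (FinConf.lebesguePoisson_eq_zero_iff hdim hU).2 hpos.ne'
  push Not at h1
  obtain ⟨n, hn⟩ := h1
  exact Set.eq_univ_of_forall (FinConf.induction_insert (h.empty_mem_of_volume_pos hU hcl hn)
    fun x η hη => h.insert_mem_of_mem hU hcl hη x)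

end Closed

end AdmissibleRates

theorem theorem4p1 (dim : ℕ) (hdim : 1 ≤ dim) (b d : Space dim → FinConf dim → ℝ≥0)
    (h : AdmissibleRates b d) :
    IsMaximalIrreducibilityMeasure h.jumpKernel (FinConf.lebesguePoisson dim) := by
  refine ⟨FinConf.sigmaFinite_lebesguePoisson hdim, fun h0 => ?_, fun A hA => ⟨fun hret => ?_,
    fun hpos => returnProb_pos_of_forall_closed hA fun U hU hAU hcl =>
      h.eq_univ_of_lebesguePoisson_pos hdim hU hcl (hpos.trans_le (measure_mono hAU))⟩⟩
  · exact FinConf.lebesguePoisson_ne_zero_of_empty_mem hdim MeasurableSet.univ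
      (Set.mem_univ _) (by simp [h0])
  · by_contra h0
    -- The starting point `∅` suffices: if `A` is null, so is every set of points reaching it, and
    -- none of these can contain an atom.
    obtain ⟨n, hn⟩ := (returnProb_pos_iff FinConf.empty hA).1 (hret _)
    exact FinConf.lebesguePoisson_ne_zero_of_empty_mem hdim (measurableSet_reachSet hA _) hn
      (measure_reachSet_eq_zero hA
        (fun _ => h.lebesguePoisson_jumpKernel_pos_eq_zero hdim)
        (nonpos_iff_eq_zero.1 (not_lt.1 h0)) (n + 1))
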